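/- All graphs are finite and simple. Let $(\Omega,\mu)$ be a probability space. A graphon on $\Omega$ is a measurable function $W:\Omega^2\to[0,1]$ with $W(x,y)=W(y,x)$ for all $x,y\in\Omega$. For a graph $H$ with vertex set $V(H)$ and edge set $E(H)$, put $$t(H,W)=\mathbb{E}\Bigl(\prod_{\{i,j\}\in E(H)}W(x_i,x_j)\Bigr),$$ where the points $x_i$, $i\in V(H)$, are chosen independently from $\Omega$ with law $\mu$. Let $P_2$ denote the graph with two vertices and a single edge. A graph $H$ is called a Sidorenko graph if it is bipartite and $t(H,W)\ge t(P_2,W)^{|E(H)|}$ for every graphon $W$ on every probability space. Theorem (Edge gluing). Let $H_1,H_2$ be Sidorenko graphs, and let $a_1b_1\in E(H_1)$ and $a_2b_2\in E(H_2)$ be arbitrary edges, each with an arbitrary choice of the order of its endpoints. Then the graph obtained from the disjoint union of $H_1$ and $H_2$ by identifying $a_1$ with $a_2$ and $b_1$ with $b_2$ (so that the two edges become a single edge) is again a Sidorenko graph. In particular, this holds for both of the ways in which the two edges can be identified. -/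

import Mathlib

universe u v w

open MeasureTheory

/-- A graphon on a measurable space `Ω`: a symmetric measurable function `Ω × Ω → [0,1]`. -/
structure Graphon (Ω : Type*) [MeasurableSpace Ω] where
  toFun : Ω → Ω → ℝ
  measurable' : Measurable (Function.uncurry toFun)
  symm' : ∀ x y, toFun x y = toFun y x
  mem_Icc' : ∀ x y, toFun x y ∈ Set.Icc (0 : ℝ) 1

/-- The value `W (x i) (x j)` at an unordered pair `e = {i, j}` of vertices, where `x` assigns
points of `Ω` to the vertices. -/
def Graphon.onPair {Ω V : Type*} [MeasurableSpace Ω] (W : Graphon Ω) (x : V → Ω) (e : Sym2 V) : ℝ :=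
  Sym2.lift ⟨fun i j => W.toFun (x i) (x j), fun i j => W.symm' (x i) (x j)⟩ e

open Classical in
/-- The subgraph density `t(H, W)`: the expectation of the product of `W (x i) (x j)` over all edges
`{i, j}` of `H`, where the points `x i` (for `i` a vertex of `H`) are independent with law `μ`. -/
noncomputable def graphonDensity {Ω V : Type*} [MeasurableSpace Ω] [Fintype V]
    (H : SimpleGraph V) (μ : Measure Ω) (W : Graphon Ω) : ℝ :=
  ∫ x : V → Ω, ∏ e ∈ H.edgeFinset, W.onPair x e ∂(Measure.pi fun _ : V => μ)

open Classical in
/-- A Sidorenko graph: a bipartite graph `H` such that `t(H, W) ≥ t(P₂, W) ^ |E(H)|` for every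
graphon `W` on every probability space; `P₂` is the path on two vertices, that is, a single edge. -/
def IsSidorenko {V : Type u} [Fintype V] (H : SimpleGraph V) : Prop :=
  H.IsBipartite ∧
    ∀ (Ω : Type w) [MeasurableSpace Ω] (μ : Measure Ω) [IsProbabilityMeasure μ] (W : Graphon Ω),
      graphonDensity (SimpleGraph.pathGraph 2) μ W ^ H.edgeFinset.card ≤ graphonDensity H μ W

/-- The vertices of the graph obtained by identifying `a₂, b₂ : V₂` with two vertices of `V₁`:
those of `V₁`, and those of `V₂` other than `a₂` and `b₂`. -/
abbrev GluedVertex (V₁ : Type*) {V₂ : Type*} (a₂ b₂ : V₂) : Type _ :=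
  V₁ ⊕ {v : V₂ // v ≠ a₂ ∧ v ≠ b₂}

open Classical in
noncomputable instance GluedVertex.instFintype (V₁ : Type*) {V₂ : Type*} [Fintype V₁] [Fintype V₂]
    (a₂ b₂ : V₂) : Fintype (GluedVertex V₁ a₂ b₂) :=
  inferInstanceAs (Fintype (V₁ ⊕ {v : V₂ // v ≠ a₂ ∧ v ≠ b₂}))

open Classical in
/-- The map that sends a vertex of the second graph to the corresponding vertex of the glued graph:
`a₂` goes to `a₁`, `b₂` goes to `b₁`, and every other vertex to itself. -/
noncomputable def gluedVertexOfRight {V₁ V₂ : Type*} (a₁ b₁ : V₁) (a₂ b₂ : V₂) (v : V₂) :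
    GluedVertex V₁ a₂ b₂ :=
  if ha : v = a₂ then Sum.inl a₁ else if hb : v = b₂ then Sum.inl b₁ else Sum.inr ⟨v, ha, hb⟩

/-- The graph obtained from the disjoint union of `H₁` and `H₂` by identifying `a₁` with `a₂` and
`b₁` with `b₂`: its edges are the images of the edges of `H₁` and of the edges of `H₂`. When
`a₁ b₁` and `a₂ b₂` are edges, they become one edge. -/
noncomputable def edgeGluing {V₁ V₂ : Type*} (H₁ : SimpleGraph V₁) (H₂ : SimpleGraph V₂) (a₁ b₁ : V₁)
    (a₂ b₂ : V₂) : SimpleGraph (GluedVertex V₁ a₂ b₂) :=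
  H₁.map Sum.inl ⊔ H₂.map (gluedVertexOfRight a₁ b₁ a₂ b₂)

/-! Consider a finite weighted target with edge density p whose automorphisms act transitively on
ordered pairs of nonzero edge weight. The weighted number q_i of extensions of such a pair to a map
of H_i is then constant, so H_1, H_2 and the glued graph have densities p q_1, p q_2 and p q_1 q_2.
The Sidorenko inequalities give p q_1 ≥ p^{e_1} and, after cancelling p, q_2 ≥ p^{e_2 - 1};
multiplying them proves the claim (`edgeSum_pow_le_homSum_edgeGluing_of_transitive`).

A general finite target is reduced to this case by tensor powers and the method of types. In a
tensor power with 2M coordinates, the pairs of a fixed symmetric type lie in one orbit of the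
coordinate permutations (`tensorOfType_transitive`). The number of types is polynomial in M, so some
class retains the edge density up to a polynomial factor (`exists_symmetric_type_sum_ge`), which
disappears as M grows (`le_of_forall_pow_div_le`).

Finite targets are graphons on finite spaces. Conversely, every graphon is an L¹ limit of symmetric
step functions (`Graphon.exists_step_approx`), and densities are L¹-continuous
(`abs_graphonDensity_sub_le`). -/

section FiniteSums

/-! ### Weighted homomorphism counts and their factorisation over the glued edge. -/

open Classical

/-- The number of homomorphisms from `H` to a finite weighted graph, with vertex weights `m` and
edge weights `ω`. -/
noncomputable def homSum {V β : Type*} [Fintype V] [Fintype β] (H : SimpleGraph V) (m : β → ℝ)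
    (ω : Sym2 β → ℝ) : ℝ :=
  ∑ x : V → β, (∏ v, m (x v)) * ∏ e ∈ H.edgeFinset, ω (e.map x)

/-- The total weight of the ordered edges of a finite weighted graph. -/
noncomputable def edgeSum {β : Type*} [Fintype β] (m : β → ℝ) (ω : Sym2 β → ℝ) : ℝ :=
  ∑ p : β × β, m p.1 * m p.2 * ω s(p.1, p.2)

/-- The Sidorenko inequality for finite weighted target graphs. -/
def FiniteSidorenko {V : Type u} [Fintype V] (H : SimpleGraph V) : Prop :=
  ∀ (β : Type w) [Fintype β] (m : β → ℝ) (ω : Sym2 β → ℝ), (∀ b, 0 ≤ m b) → ∑ b, m b = 1 →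
    (∀ e, ω e ∈ Set.Icc (0 : ℝ) 1) → edgeSum m ω ^ H.edgeFinset.card ≤ homSum H m ω

/-- The map on the vertices of a graph with prescribed values `s`, `t` at the roots `a`, `b`. -/
noncomputable def extendRoots {V β : Type*} (a b : V) (s t : β) (y : {v : V // v ≠ a ∧ v ≠ b} → β)
    (v : V) : β :=
  if ha : v = a then s else if hb : v = b then t else y ⟨v, ha, hb⟩

/-- The weighted number of extensions of a map of the edge `ab` of `H` to a homomorphism,
without the weights of the vertices `a`, `b` and of the edge `ab`. -/
noncomputable def rootedSum {V β : Type*} [Fintype V] [Fintype β] (H : SimpleGraph V) (a b : V)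
    (m : β → ℝ) (ω : Sym2 β → ℝ) (s t : β) : ℝ :=
  ∑ y : {v : V // v ≠ a ∧ v ≠ b} → β,
    (∏ v, m (y v)) * ∏ e ∈ H.edgeFinset.erase s(a, b), ω (e.map (extendRoots a b s t y))

/-- A map on vertices is given by its values at two roots and its restriction to the others. -/
noncomputable def rootsEquiv {V : Type*} (β : Type*) {a b : V} (hab : a ≠ b) :
    (V → β) ≃ (β × β) × ({v : V // v ≠ a ∧ v ≠ b} → β) where
  toFun x := ((x a, x b), fun v => x v)
  invFun p := extendRoots a b p.1.1 p.1.2 p.2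
  left_inv x := by
    ext v
    simp only [extendRoots]
    split_ifs with h h' <;> simp [*]
  right_inv p := by
    obtain ⟨⟨s, t⟩, y⟩ := p
    refine Prod.ext (Prod.ext ?_ ?_) ?_
    · simp [extendRoots]
    · simp [extendRoots, hab.symm]
    · ext v
      simp [extendRoots, v.2.1, v.2.2]

theorem prod_eq_mul_prod_off_roots {V : Type*} [Fintype V] {a b : V} (hab : a ≠ b) (f : V → ℝ) :
    ∏ v, f v = f a * f b * ∏ v : {v : V // v ≠ a ∧ v ≠ b}, f v := by
  rw [← Finset.prod_mul_prod_compl {a, b} f, Finset.prod_pair hab]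
  congr 1
  exact Finset.prod_subtype _ (by intro x; simp) f

/-- The free factor `F` at the roots is the slot into which the extension count of the second graph
is later inserted. -/
theorem sum_mul_eq_sum_rootedSum {V β : Type*} [Fintype V] [Fintype β] (H : SimpleGraph V) {a b : V}
    (h : H.Adj a b) (m : β → ℝ) (ω : Sym2 β → ℝ) (F : β → β → ℝ) :
    ∑ x : V → β, ((∏ v, m (x v)) * ∏ e ∈ H.edgeFinset, ω (e.map x)) * F (x a) (x b) =
      ∑ p : β × β, m p.1 * m p.2 * ω s(p.1, p.2) * rootedSum H a b m ω p.1 p.2 * F p.1 p.2 := by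
  rw [← (rootsEquiv β h.ne).symm.sum_comp, Fintype.sum_prod_type]
  refine Finset.sum_congr rfl fun p _ => ?_
  rw [rootedSum, Finset.mul_sum, Finset.sum_mul]
  refine Finset.sum_congr rfl fun y _ => ?_
  obtain ⟨s, t⟩ := p
  have hx : (rootsEquiv β h.ne).symm ((s, t), y) = extendRoots a b s t y := rfl
  have hs : extendRoots a b s t y a = s := by simp [extendRoots]
  have ht : extendRoots a b s t y b = t := by simp [extendRoots, h.ne.symm]
  have hy : ∀ v : {v : V // v ≠ a ∧ v ≠ b}, extendRoots a b s t y v = y v := fun v => by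
    simp [extendRoots, v.2.1, v.2.2]
  have hmem : s(a, b) ∈ H.edgeFinset := by simpa using h
  rw [hx, prod_eq_mul_prod_off_roots h.ne, ← Finset.mul_prod_erase _ _ hmem]
  simp only [Sym2.map_mk, hs, ht, hy]
  ring

theorem homSum_eq_sum_rootedSum {V β : Type*} [Fintype V] [Fintype β] (H : SimpleGraph V) {a b : V}
    (h : H.Adj a b) (m : β → ℝ) (ω : Sym2 β → ℝ) :
    homSum H m ω =
      ∑ p : β × β, m p.1 * m p.2 * ω s(p.1, p.2) * rootedSum H a b m ω p.1 p.2 := by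
  simpa [homSum] using sum_mul_eq_sum_rootedSum H h m ω fun _ _ => 1

theorem sum_elim_comp_gluedVertexOfRight {V₁ V₂ β : Type*} (a₁ b₁ : V₁) (a₂ b₂ : V₂) (x : V₁ → β)
    (y : {v : V₂ // v ≠ a₂ ∧ v ≠ b₂} → β) :
    Sum.elim x y ∘ gluedVertexOfRight a₁ b₁ a₂ b₂ = extendRoots a₂ b₂ (x a₁) (x b₁) y := by
  ext v
  simp only [Function.comp, gluedVertexOfRight, extendRoots]
  split_ifs <;> rfl

theorem gluedVertexOfRight_injective {V₁ V₂ : Type*} {a₁ b₁ : V₁} (h₁ : a₁ ≠ b₁) (a₂ b₂ : V₂) :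
    Function.Injective (gluedVertexOfRight a₁ b₁ a₂ b₂) := by
  intro v v' h
  simp only [gluedVertexOfRight] at h
  split_ifs at h <;> simp_all

theorem SimpleGraph.mem_edgeSet_map_iff {V W : Type*} (G : SimpleGraph V) {f : V → W}
    (hf : Function.Injective f) (e : Sym2 W) :
    e ∈ (G.map f).edgeSet ↔ ∃ d ∈ G.edgeSet, d.map f = e := by
  rw [show G.map f = G.map (⟨f, hf⟩ : V ↪ W) from rfl, SimpleGraph.edgeSet_map]
  rfl

/-- The edge `a₂b₂` is erased because its image is already the image of `a₁b₁`; the union then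
becomes disjoint. -/
theorem edgeFinset_edgeGluing {V₁ V₂ : Type*} [Fintype V₁] [Fintype V₂] (H₁ : SimpleGraph V₁)
    (H₂ : SimpleGraph V₂) {a₁ b₁ : V₁} {a₂ b₂ : V₂} (h₁ : H₁.Adj a₁ b₁) (h₂ : H₂.Adj a₂ b₂) :
    (edgeGluing H₁ H₂ a₁ b₁ a₂ b₂).edgeFinset =
      H₁.edgeFinset.image (Sym2.map Sum.inl) ∪
        (H₂.edgeFinset.erase s(a₂, b₂)).image (Sym2.map (gluedVertexOfRight a₁ b₁ a₂ b₂)) := by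
  have hf := gluedVertexOfRight_injective h₁.ne a₂ b₂
  have ha : gluedVertexOfRight a₁ b₁ a₂ b₂ a₂ = Sum.inl a₁ := by simp [gluedVertexOfRight]
  have hb : gluedVertexOfRight a₁ b₁ a₂ b₂ b₂ = Sum.inl b₁ := by
    simp [gluedVertexOfRight, h₂.ne.symm]
  ext e
  rw [SimpleGraph.mem_edgeFinset, edgeGluing, SimpleGraph.edgeSet_sup]
  simp only [Set.mem_union, Finset.mem_union, Finset.mem_image, Finset.mem_erase,
    SimpleGraph.mem_edgeFinset]
  rw [SimpleGraph.mem_edgeSet_map_iff H₁ Sum.inl_injective, SimpleGraph.mem_edgeSet_map_iff H₂ hf]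
  constructor
  · rintro (h | ⟨d, hd, rfl⟩)
    · exact Or.inl h
    · by_cases hd' : d = s(a₂, b₂)
      · exact Or.inl ⟨s(a₁, b₁), h₁, by simp [hd', ha, hb]⟩
      · exact Or.inr ⟨d, ⟨hd', hd⟩, rfl⟩
  · rintro (h | ⟨d, ⟨_, hd⟩, rfl⟩)
    · exact Or.inl h
    · exact Or.inr ⟨d, hd, rfl⟩

theorem disjoint_edges_edgeGluing {V₁ V₂ : Type*} [Fintype V₁] [Fintype V₂] (H₁ : SimpleGraph V₁)
    (H₂ : SimpleGraph V₂) (a₁ b₁ : V₁) (a₂ b₂ : V₂) :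
    Disjoint (H₁.edgeFinset.image (Sym2.map Sum.inl))
      ((H₂.edgeFinset.erase s(a₂, b₂)).image
        (Sym2.map (gluedVertexOfRight a₁ b₁ a₂ b₂))) := by
  rw [Finset.disjoint_left]
  intro e h h'
  obtain ⟨d, -, rfl⟩ := Finset.mem_image.1 h
  obtain ⟨d', hd', hdd⟩ := Finset.mem_image.1 h'
  obtain ⟨hne, hd'⟩ := Finset.mem_erase.1 hd'
  -- Only the two roots of the second graph land in `V₁`, so a common edge could only be the erased
  -- one.
  have hroot : ∀ v ∈ d', v = a₂ ∨ v = b₂ := by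
    intro v hv
    have := (Sym2.mem_map (f := gluedVertexOfRight a₁ b₁ a₂ b₂)).2 ⟨v, hv, rfl⟩
    rw [hdd] at this
    obtain ⟨u, -, hu⟩ := Sym2.mem_map.1 this
    by_contra hc
    push Not at hc
    simp [gluedVertexOfRight, hc.1, hc.2] at hu
  induction d' with | _ p q =>
  have hpq : p ≠ q := (show H₂.Adj p q by simpa using hd').ne
  have hp := hroot p (by simp)
  have hq := hroot q (by simp)
  rcases hp with rfl | rfl <;> rcases hq with rfl | rfl
  · exact hpq rfl
  · exact hne rfl
  · exact hne Sym2.eq_swap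
  · exact hpq rfl

theorem prod_edgeFinset_edgeGluing {M : Type*} [CommMonoid M] {V₁ V₂ : Type*} [Fintype V₁]
    [Fintype V₂] (H₁ : SimpleGraph V₁) (H₂ : SimpleGraph V₂) {a₁ b₁ : V₁} {a₂ b₂ : V₂}
    (h₁ : H₁.Adj a₁ b₁) (h₂ : H₂.Adj a₂ b₂) (f : Sym2 (GluedVertex V₁ a₂ b₂) → M) :
    ∏ e ∈ (edgeGluing H₁ H₂ a₁ b₁ a₂ b₂).edgeFinset, f e =
      (∏ e ∈ H₁.edgeFinset, f (e.map Sum.inl)) *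
        ∏ e ∈ H₂.edgeFinset.erase s(a₂, b₂), f (e.map (gluedVertexOfRight a₁ b₁ a₂ b₂)) := by
  rw [edgeFinset_edgeGluing H₁ H₂ h₁ h₂,
    Finset.prod_union (disjoint_edges_edgeGluing H₁ H₂ a₁ b₁ a₂ b₂),
    Finset.prod_image (Sym2.map.injective Sum.inl_injective).injOn,
    Finset.prod_image (Sym2.map.injective (gluedVertexOfRight_injective h₁.ne a₂ b₂)).injOn]

theorem card_edgeFinset_edgeGluing {V₁ V₂ : Type*} [Fintype V₁] [Fintype V₂] (H₁ : SimpleGraph V₁)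
    (H₂ : SimpleGraph V₂) {a₁ b₁ : V₁} {a₂ b₂ : V₂} (h₁ : H₁.Adj a₁ b₁) (h₂ : H₂.Adj a₂ b₂) :
    (edgeGluing H₁ H₂ a₁ b₁ a₂ b₂).edgeFinset.card =
      H₁.edgeFinset.card + (H₂.edgeFinset.card - 1) := by
  rw [edgeFinset_edgeGluing H₁ H₂ h₁ h₂,
    Finset.card_union_of_disjoint (disjoint_edges_edgeGluing H₁ H₂ a₁ b₁ a₂ b₂),
    Finset.card_image_of_injective _ (Sym2.map.injective Sum.inl_injective),
    Finset.card_image_of_injective _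
      (Sym2.map.injective (gluedVertexOfRight_injective h₁.ne a₂ b₂)),
    Finset.card_erase_of_mem (by simpa using h₂)]

/-- Once the glued edge is placed, the extensions to the two graphs are chosen independently, and
the weight of the shared edge occurs once. -/
theorem homSum_edgeGluing {V₁ V₂ β : Type*} [Fintype V₁] [Fintype V₂] [Fintype β]
    (H₁ : SimpleGraph V₁) (H₂ : SimpleGraph V₂) {a₁ b₁ : V₁} {a₂ b₂ : V₂} (h₁ : H₁.Adj a₁ b₁)
    (h₂ : H₂.Adj a₂ b₂) (m : β → ℝ) (ω : Sym2 β → ℝ) :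
    homSum (edgeGluing H₁ H₂ a₁ b₁ a₂ b₂) m ω =
      ∑ p : β × β, m p.1 * m p.2 * ω s(p.1, p.2) * rootedSum H₁ a₁ b₁ m ω p.1 p.2 *
        rootedSum H₂ a₂ b₂ m ω p.1 p.2 := by
  have hE := Finset.sum_equiv (s := Finset.univ) (t := Finset.univ)
    (Equiv.sumArrowEquivProdArrow V₁ {v : V₂ // v ≠ a₂ ∧ v ≠ b₂} β)
    (f := fun x => (∏ v, m (x v)) *
      ∏ e ∈ (edgeGluing H₁ H₂ a₁ b₁ a₂ b₂).edgeFinset, ω (e.map x))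
    (g := fun p => (∏ v, m (Sum.elim p.1 p.2 v)) *
      ∏ e ∈ (edgeGluing H₁ H₂ a₁ b₁ a₂ b₂).edgeFinset, ω (e.map (Sum.elim p.1 p.2)))
    (by simp) (fun x _ => by simp [Equiv.sumArrowEquivProdArrow])
  rw [← sum_mul_eq_sum_rootedSum H₁ h₁ m ω (rootedSum H₂ a₂ b₂ m ω), homSum]
  refine (Eq.trans (by congr!) hE).trans ?_
  rw [Fintype.sum_prod_type]
  refine Finset.sum_congr rfl fun x _ => ?_
  rw [rootedSum, Finset.mul_sum]
  refine Finset.sum_congr rfl fun y _ => ?_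
  rw [prod_edgeFinset_edgeGluing H₁ H₂ h₁ h₂]
  simp only [Sym2.map_map, sum_elim_comp_gluedVertexOfRight, Sum.elim_comp_inl]
  have : ∏ v : GluedVertex V₁ a₂ b₂, m (Sum.elim x y v) = (∏ v, m (x v)) * ∏ v, m (y v) := by
    convert Fintype.prod_sum_type (fun v : GluedVertex V₁ a₂ b₂ => m (Sum.elim x y v)) <;> rfl
  rw [this]
  ring

/-! ### Edge-transitive targets. -/

theorem rootedSum_apply_perm {V β : Type*} [Fintype V] [Fintype β] (H : SimpleGraph V) (a b : V)
    {m : β → ℝ} {ω : Sym2 β → ℝ} (τ : Equiv.Perm β) (hm : ∀ s, m (τ s) = m s)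
    (hω : ∀ e, ω (e.map τ) = ω e) (s t : β) :
    rootedSum H a b m ω (τ s) (τ t) = rootedSum H a b m ω s t := by
  rw [rootedSum, rootedSum, ← (Equiv.arrowCongr (Equiv.refl _) τ).sum_comp]
  refine Finset.sum_congr rfl fun y _ => ?_
  have h : extendRoots a b (τ s) (τ t) (Equiv.arrowCongr (Equiv.refl _) τ y) =
      τ ∘ extendRoots a b s t y := by
    ext v
    simp only [Function.comp, extendRoots]
    split_ifs <;> rfl
  rw [h]
  simp only [← Sym2.map_map, hω]
  simp [hm]

theorem rootedSum_eq_of_transitive {V β : Type*} [Fintype V] [Fintype β] (H : SimpleGraph V)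
    (a b : V) {m : β → ℝ} {ω : Sym2 β → ℝ}
    (htrans : ∀ s t s' t', ω s(s, t) ≠ 0 → ω s(s', t') ≠ 0 → ∃ τ : Equiv.Perm β,
      (∀ b, m (τ b) = m b) ∧ (∀ e, ω (e.map τ) = ω e) ∧ τ s = s' ∧ τ t = t') {s t s' t' : β}
    (h : ω s(s, t) ≠ 0) (h' : ω s(s', t') ≠ 0) :
    rootedSum H a b m ω s t = rootedSum H a b m ω s' t' := by
  obtain ⟨τ, hm, hω, rfl, rfl⟩ := htrans s t s' t' h h'
  exact (rootedSum_apply_perm H a b τ hm hω _ _).symm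

theorem homSum_nonneg {V β : Type*} [Fintype V] [Fintype β] (H : SimpleGraph V) {m : β → ℝ}
    {ω : Sym2 β → ℝ} (hm : ∀ b, 0 ≤ m b) (hω : ∀ e, 0 ≤ ω e) : 0 ≤ homSum H m ω :=
  Finset.sum_nonneg fun _ _ => mul_nonneg (Finset.prod_nonneg fun _ _ => hm _)
    (Finset.prod_nonneg fun _ _ => hω _)

theorem edgeSum_nonneg {β : Type*} [Fintype β] {m : β → ℝ}
    {ω : Sym2 β → ℝ} (hm : ∀ b, 0 ≤ m b) (hω : ∀ e, 0 ≤ ω e) : 0 ≤ edgeSum m ω :=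
  Finset.sum_nonneg fun _ _ => mul_nonneg (mul_nonneg (hm _) (hm _)) (hω _)

theorem one_le_card_edgeFinset {V : Type*} [Fintype V] {H : SimpleGraph V} {a b : V}
    (h : H.Adj a b) : 1 ≤ H.edgeFinset.card :=
  Finset.card_pos.2 ⟨s(a, b), by simpa using h⟩

/-- The Sidorenko inequality for the glued graph, for edge-transitive targets. -/
theorem edgeSum_pow_le_homSum_edgeGluing_of_transitive {V₁ : Type u} {V₂ : Type v} {β : Type w}
    [Fintype V₁] [Fintype V₂] [Fintype β] {H₁ : SimpleGraph V₁} {H₂ : SimpleGraph V₂}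
    (hH₁ : FiniteSidorenko.{u, w} H₁) (hH₂ : FiniteSidorenko.{v, w} H₂) {a₁ b₁ : V₁} {a₂ b₂ : V₂}
    (h₁ : H₁.Adj a₁ b₁) (h₂ : H₂.Adj a₂ b₂) {m : β → ℝ} {ω : Sym2 β → ℝ} (hm : ∀ b, 0 ≤ m b)
    (hm1 : ∑ b, m b = 1) (hω : ∀ e, ω e ∈ Set.Icc (0 : ℝ) 1)
    (htrans : ∀ s t s' t', ω s(s, t) ≠ 0 → ω s(s', t') ≠ 0 → ∃ τ : Equiv.Perm β,
      (∀ b, m (τ b) = m b) ∧ (∀ e, ω (e.map τ) = ω e) ∧ τ s = s' ∧ τ t = t') :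
    edgeSum m ω ^ (edgeGluing H₁ H₂ a₁ b₁ a₂ b₂).edgeFinset.card ≤
      homSum (edgeGluing H₁ H₂ a₁ b₁ a₂ b₂) m ω := by
  have hc₁ := one_le_card_edgeFinset h₁
  have hc₂ := one_le_card_edgeFinset h₂
  rw [card_edgeFinset_edgeGluing H₁ H₂ h₁ h₂]
  have hp := edgeSum_nonneg hm fun e => (hω e).1
  -- At density zero there may be no edge to read the constants from, and no cancellation; the
  -- exponent is positive, so the left side vanishes.
  rcases hp.eq_or_lt with hp0 | hp0
  · rw [← hp0, zero_pow (by omega)]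
    exact homSum_nonneg _ hm fun e => (hω e).1
  obtain ⟨⟨s, t⟩, -, hst⟩ := Finset.exists_ne_zero_of_sum_ne_zero hp0.ne'
  have hst : ω s(s, t) ≠ 0 := right_ne_zero_of_mul hst
  have hconst := fun p : β × β => fun hp : ω s(p.1, p.2) ≠ 0 =>
    rootedSum_eq_of_transitive H₁ a₁ b₁ htrans hp hst
  have hconst₂ := fun p : β × β => fun hp : ω s(p.1, p.2) ≠ 0 =>
    rootedSum_eq_of_transitive H₂ a₂ b₂ htrans hp hst
  set q₁ := rootedSum H₁ a₁ b₁ m ω s t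
  set q₂ := rootedSum H₂ a₂ b₂ m ω s t
  have e₁ : homSum H₁ m ω = edgeSum m ω * q₁ := by
    rw [homSum_eq_sum_rootedSum H₁ h₁, edgeSum, Finset.sum_mul]
    refine Finset.sum_congr rfl fun p _ => ?_
    by_cases hp : ω s(p.1, p.2) = 0
    · simp [hp]
    · rw [hconst p hp]
  have e₂ : homSum H₂ m ω = edgeSum m ω * q₂ := by
    rw [homSum_eq_sum_rootedSum H₂ h₂, edgeSum, Finset.sum_mul]
    refine Finset.sum_congr rfl fun p _ => ?_
    by_cases hp : ω s(p.1, p.2) = 0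
    · simp [hp]
    · rw [hconst₂ p hp]
  have e₃ : homSum (edgeGluing H₁ H₂ a₁ b₁ a₂ b₂) m ω = edgeSum m ω * q₁ * q₂ := by
    rw [homSum_edgeGluing H₁ H₂ h₁ h₂, edgeSum, Finset.sum_mul, Finset.sum_mul]
    refine Finset.sum_congr rfl fun p _ => ?_
    by_cases hp : ω s(p.1, p.2) = 0
    · simp [hp]
    · rw [hconst p hp, hconst₂ p hp]
  have i₁ := hH₁ β m ω hm hm1 hω
  have i₂ := hH₂ β m ω hm hm1 hω
  rw [e₁] at i₁
  -- Cancelling one factor of the edge density leaves `i₂` as a lower bound for `q₂` with exponent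
  -- one less.
  rw [e₂, ← Nat.sub_add_cancel hc₂, pow_succ', mul_le_mul_iff_right₀ hp0] at i₂
  rw [e₃, pow_add]
  exact mul_le_mul i₁ i₂ (by positivity) ((pow_nonneg hp _).trans i₁)

end FiniteSums

/-! ### Tensor powers and the method of types. -/

section TensorPower

theorem sum_prod_comp_eq_pow {ι γ : Type*} [Fintype ι] [DecidableEq ι] [Fintype γ] (g : γ → ℝ) :
    ∑ z : ι → γ, ∏ i, g (z i) = (∑ d, g d) ^ Fintype.card ι := by
  classical
  have h := Finset.prod_univ_sum (fun _ : ι => (Finset.univ : Finset γ)) (fun _ d => g d)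
  rw [Fintype.piFinset_univ] at h
  rw [← h]
  simp

-- A map into the power is a family of maps into the base, one per coordinate, and all weights
-- multiply over the coordinates.
open Classical in
theorem homSum_tensor {V α ι : Type*} [Fintype V] [Fintype α] [Fintype ι] [DecidableEq ι]
    (H : SimpleGraph V) (m : α → ℝ) (ω : Sym2 α → ℝ) :
    homSum H (fun x : ι → α => ∏ i, m (x i)) (fun e => ∏ i, ω (e.map fun x => x i)) =
      homSum H m ω ^ Fintype.card ι := by
  rw [homSum, homSum, ← sum_prod_comp_eq_pow]
  refine Finset.sum_equiv (Equiv.piComm fun _ _ => α) (by simp) fun X _ => ?_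
  rw [Finset.prod_mul_distrib, Finset.prod_comm, Finset.prod_comm (s := H.edgeFinset)]
  simp only [Sym2.map_map]
  rfl

open Classical in
/-- The number of occurrences of each value in a finite family. -/
noncomputable def typeCount {ι γ : Type*} [Fintype ι] (z : ι → γ) (d : γ) : ℕ :=
  (Finset.univ.filter fun i => z i = d).card

theorem typeCount_comp_perm {ι γ : Type*} [Fintype ι] (z : ι → γ) (σ : Equiv.Perm ι) :
    typeCount (z ∘ σ) = typeCount z := by
  classical
  ext d
  exact Finset.card_equiv σ (by simp)

/-- Fibres over each value have equal size, so bijections between them assemble to a permutation: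
types are the orbits of coordinate permutations. -/
theorem exists_perm_of_typeCount_eq {ι γ : Type*} [Fintype ι] {z z' : ι → γ}
    (h : typeCount z = typeCount z') : ∃ σ : Equiv.Perm ι, z' ∘ σ = z := by
  classical
  have hc : ∀ d, Nonempty ({i // z i = d} ≃ {i // z' i = d}) := fun d => by
    refine ⟨Fintype.equivOfCardEq ?_⟩
    rw [Fintype.card_subtype, Fintype.card_subtype]
    have := congrFun h d
    simp only [typeCount] at this
    convert this
  exact ⟨Equiv.ofFiberEquiv fun d => (hc d).some, funext fun i => Equiv.ofFiberEquiv_map _ i⟩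

theorem typeCount_comp_equiv {ι γ δ : Type*} [Fintype ι] (z : ι → γ) (φ : γ ≃ δ) (d : δ) :
    typeCount (φ ∘ z) d = typeCount z (φ.symm d) := by
  classical
  simp only [typeCount, Function.comp, Equiv.eq_symm_apply]

theorem typeCount_sum {ι κ γ : Type*} [Fintype ι] [Fintype κ] (z : ι ⊕ κ → γ) :
    typeCount z = typeCount (z ∘ Sum.inl) + typeCount (z ∘ Sum.inr) := by
  classical
  ext d
  simp only [typeCount, Pi.add_apply, Function.comp, Finset.card_filter, Fintype.sum_sum_type]

theorem typeCount_lt {M : ℕ} {γ : Type*} (z : Fin M → γ) (d : γ) : typeCount z d < M + 1 := by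
  classical
  exact Nat.lt_succ_of_le ((Finset.card_le_univ _).trans (by simp))

open Classical in
/-- The tensor power of an edge weight, restricted to the edges with a given type. -/
noncomputable def tensorOfType {α ι : Type*} [Fintype ι] (ω : Sym2 α → ℝ) (c : α × α → ℕ)
    (e : Sym2 (ι → α)) : ℝ :=
  if ∀ x y, e = s(x, y) → typeCount (fun i => (x i, y i)) = c then
    ∏ i, ω (e.map fun x => x i) else 0

-- Reversing an edge turns its type into the swapped type, so for symmetric `c` both orderings of an
-- unordered pair satisfy the condition or neither does.
open Classical in
theorem tensorOfType_mk {α ι : Type*} [Fintype ι] (ω : Sym2 α → ℝ) {c : α × α → ℕ}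
    (hc : ∀ p, c p.swap = c p) (x y : ι → α) :
    tensorOfType ω c s(x, y) =
      if typeCount (fun i => (x i, y i)) = c then ∏ i, ω s(x i, y i) else 0 := by
  have h : (∀ x' y', s(x, y) = s(x', y') → typeCount (fun i => (x' i, y' i)) = c) ↔
      typeCount (fun i => (x i, y i)) = c := by
    refine ⟨fun h => h x y rfl, fun h x' y' he => ?_⟩
    rcases Sym2.eq_iff.1 he with ⟨rfl, rfl⟩ | ⟨rfl, rfl⟩
    · exact h
    · ext p
      rw [← hc p, ← h]
      exact typeCount_comp_equiv (fun i => (x i, y i)) (Equiv.prodComm α α) p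
  rw [tensorOfType]
  simp only [h, Sym2.map_mk]

theorem tensorOfType_mem_Icc {α ι : Type*} [Fintype ι] {ω : Sym2 α → ℝ}
    (hω : ∀ e, ω e ∈ Set.Icc (0 : ℝ) 1) (c : α × α → ℕ) (e : Sym2 (ι → α)) :
    tensorOfType ω c e ∈ Set.Icc (0 : ℝ) 1 := by
  rw [tensorOfType]
  split_ifs
  · exact ⟨Finset.prod_nonneg fun i _ => (hω _).1,
      Finset.prod_le_one (fun i _ => (hω _).1) fun i _ => (hω _).2⟩
  · simp

theorem tensorOfType_le {α ι : Type*} [Fintype ι] {ω : Sym2 α → ℝ}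
    (hω : ∀ e, ω e ∈ Set.Icc (0 : ℝ) 1) (c : α × α → ℕ) (e : Sym2 (ι → α)) :
    tensorOfType ω c e ≤ ∏ i, ω (e.map fun x => x i) := by
  rw [tensorOfType]
  split_ifs
  · exact le_rfl
  · exact Finset.prod_nonneg fun i _ => (hω _).1

theorem tensorOfType_transitive {α ι : Type*} [Fintype ι] (m : α → ℝ) (ω : Sym2 α → ℝ)
    {c : α × α → ℕ} (hc : ∀ p, c p.swap = c p) (x y x' y' : ι → α)
    (h : tensorOfType ω c s(x, y) ≠ 0) (h' : tensorOfType ω c s(x', y') ≠ 0) :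
    ∃ τ : Equiv.Perm (ι → α), (∀ b, ∏ i, m (τ b i) = ∏ i, m (b i)) ∧
      (∀ e, tensorOfType ω c (e.map τ) = tensorOfType ω c e) ∧ τ x = x' ∧ τ y = y' := by
  classical
  rw [tensorOfType_mk ω hc] at h h'
  have hx := (ite_ne_right_iff.1 h).1
  have hx' := (ite_ne_right_iff.1 h').1
  obtain ⟨σ, hσ⟩ := exists_perm_of_typeCount_eq (hx'.trans hx.symm)
  -- With `σ.symm` here, the permutation acts by `b ↦ b ∘ σ`, on both endpoints simultaneously.
  refine ⟨Equiv.arrowCongr σ.symm (Equiv.refl α), fun b => ?_, fun e => ?_, ?_, ?_⟩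
  · exact Equiv.prod_comp σ fun i => m (b i)
  · induction e with | _ s t =>
    rw [Sym2.map_mk, tensorOfType_mk ω hc, tensorOfType_mk ω hc]
    have h1 := typeCount_comp_perm (fun i => (s i, t i)) σ
    have h2 := Equiv.prod_comp σ fun i => ω s(s i, t i)
    simp only [Function.comp_def] at h1
    simp only [Equiv.arrowCongr_apply, Equiv.coe_refl, Equiv.symm_symm, Function.comp, id]
    rw [h1, h2]
  · ext i
    exact congrArg Prod.fst (congrFun hσ i)
  · ext i
    exact congrArg Prod.snd (congrFun hσ i)

open Classical in
theorem edgeSum_tensorOfType {α ι : Type*} [Fintype α] [Fintype ι] [DecidableEq ι] (m : α → ℝ)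
    (ω : Sym2 α → ℝ) {c : α × α → ℕ} (hc : ∀ p, c p.swap = c p) :
    edgeSum (fun x : ι → α => ∏ i, m (x i)) (tensorOfType ω c) =
      ∑ z : ι → α × α, if typeCount z = c then
        ∏ i, (m (z i).1 * m (z i).2 * ω s((z i).1, (z i).2)) else 0 := by
  refine (Finset.sum_equiv (Equiv.arrowProdEquivProdArrow ι (fun _ => α) (fun _ => α)) (by simp)
    fun z _ => ?_).symm
  simp only [Equiv.arrowProdEquivProdArrow, Equiv.coe_fn_mk, tensorOfType_mk ω hc, Prod.mk.eta,
    Finset.prod_mul_distrib, mul_ite, mul_zero]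

-- Pigeonhole: each entry of a type is at most `M`, so at most `(M + 1) ^ |γ|` types share the full
-- sum.
open Classical in
theorem exists_type_sum_ge {γ : Type*} [Fintype γ] (M : ℕ) (g : γ → ℝ) :
    ∃ c : γ → ℕ, (∑ d, g d) ^ M / ((M : ℝ) + 1) ^ Fintype.card γ ≤
      ∑ z : Fin M → γ, if typeCount z = c then ∏ i, g (z i) else 0 := by
  let T : (γ → Fin (M + 1)) → ℝ := fun c =>
    ∑ z : Fin M → γ, if typeCount z = (fun d => (c d : ℕ)) then ∏ i, g (z i) else 0
  have hsum : ∑ c, T c = (∑ d, g d) ^ M := by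
    rw [Finset.sum_comm]
    have h := sum_prod_comp_eq_pow (ι := Fin M) g
    rw [Fintype.card_fin] at h
    rw [← h]
    refine Finset.sum_congr rfl fun z _ => ?_
    rw [Finset.sum_eq_single (fun d => ⟨typeCount z d, typeCount_lt z d⟩)]
    · simp
    · intro c _ hne
      rw [if_neg]
      intro h
      exact hne (funext fun d => Fin.ext (congrFun h d).symm)
    · simp
  obtain ⟨c, -, hc⟩ := Finset.exists_le_of_sum_le (s := Finset.univ) (g := T)
    (f := fun _ => (∑ d, g d) ^ M / ((M : ℝ) + 1) ^ Fintype.card γ) Finset.univ_nonempty (by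
      rw [hsum, Finset.sum_const, Finset.card_univ, Fintype.card_fun, Fintype.card_fin, nsmul_eq_mul]
      push_cast
      rw [mul_div_cancel₀ _ (by positivity)])
  exact ⟨_, hc⟩

-- The heaviest type need not be symmetric. Concatenating a sequence of type `c` with one of the
-- swapped type gives a symmetric type on twice as many coordinates; since `g` is swap-invariant,
-- both halves contribute the same sum, whence the square.
open Classical in
theorem exists_symmetric_type_sum_ge {α : Type*} [Fintype α] (M : ℕ) {g : α × α → ℝ}
    (hg : ∀ d, 0 ≤ g d) (hswap : ∀ d, g d.swap = g d) :
    ∃ c : α × α → ℕ, (∀ p, c p.swap = c p) ∧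
      ((∑ d, g d) ^ M / ((M : ℝ) + 1) ^ Fintype.card (α × α)) ^ 2 ≤
        ∑ z : Fin M ⊕ Fin M → α × α, if typeCount z = c then ∏ i, g (z i) else 0 := by
  obtain ⟨c, hc⟩ := exists_type_sum_ge M g
  refine ⟨fun p => c p + c p.swap, fun p => by simp [add_comm], ?_⟩
  set S := ∑ z : Fin M → α × α, if typeCount z = c then ∏ i, g (z i) else 0
  have hS : S = ∑ z : Fin M → α × α,
      if typeCount z = (fun p => c p.swap) then ∏ i, g (z i) else 0 := by
    refine Finset.sum_equiv (Equiv.arrowCongr (Equiv.refl _) (Equiv.prodComm α α)) (by simp)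
      fun z _ => ?_
    have h : typeCount (Equiv.arrowCongr (Equiv.refl _) (Equiv.prodComm α α) z) =
        (fun p => c p.swap) ↔ typeCount z = c := by
      have h1 : typeCount (Equiv.arrowCongr (Equiv.refl _) (Equiv.prodComm α α) z) =
          fun p => typeCount z p.swap :=
        funext fun p => typeCount_comp_equiv z (Equiv.prodComm α α) p
      rw [h1]
      refine ⟨fun h => funext fun p => ?_, fun h => by rw [h]⟩
      simpa using congrFun h p.swap
    simp only [h]
    refine if_congr Iff.rfl (Finset.prod_congr rfl fun i _ => ?_) rfl
    exact (hswap _).symm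
  calc _ ≤ S ^ 2 := pow_le_pow_left₀ (by
        have := Finset.sum_nonneg fun d (_ : d ∈ Finset.univ) => hg d
        positivity) hc 2
    _ = S * ∑ z : Fin M → α × α,
        if typeCount z = (fun p => c p.swap) then ∏ i, g (z i) else 0 := by rw [← hS, sq]
    _ = ∑ q : (Fin M → α × α) × (Fin M → α × α),
        (if typeCount q.1 = c then ∏ i, g (q.1 i) else 0) *
          if typeCount q.2 = (fun p => c p.swap) then ∏ i, g (q.2 i) else 0 := by
      rw [Fintype.sum_mul_sum, Fintype.sum_prod_type]
    _ = ∑ z : Fin M ⊕ Fin M → α × α,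
        (if typeCount (z ∘ Sum.inl) = c then ∏ i, g (z (Sum.inl i)) else 0) *
          if typeCount (z ∘ Sum.inr) = (fun p => c p.swap) then ∏ i, g (z (Sum.inr i)) else 0 :=
      (Finset.sum_equiv (Equiv.sumArrowEquivProdArrow _ _ _) (by simp) fun z _ => rfl).symm
    _ ≤ _ := by
      refine Finset.sum_le_sum fun z _ => ?_
      have h0 : 0 ≤ ∏ i, g (z i) := Finset.prod_nonneg fun i _ => hg _
      by_cases h1 : typeCount (z ∘ Sum.inl) = c
      · by_cases h2 : typeCount (z ∘ Sum.inr) = fun p => c p.swap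
        · have h3 : typeCount z = fun p => c p + c p.swap := by
            rw [typeCount_sum, h1, h2]
            rfl
          rw [if_pos h1, if_pos h2, if_pos h3, Fintype.prod_sum_type]
        · rw [if_neg h2, mul_zero]
          split_ifs
          exacts [h0, le_rfl]
      · rw [if_neg h1, zero_mul]
        split_ifs
        exacts [h0, le_rfl]

open Classical in
theorem homSum_mono {V β : Type*} [Fintype V] [Fintype β] (H : SimpleGraph V) {m : β → ℝ}
    {ω ω' : Sym2 β → ℝ} (hm : ∀ b, 0 ≤ m b) (hω : ∀ e, 0 ≤ ω e) (h : ∀ e, ω e ≤ ω' e) :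
    homSum H m ω ≤ homSum H m ω' :=
  Finset.sum_le_sum fun _ _ => mul_le_mul_of_nonneg_left
    (Finset.prod_le_prod (fun _ _ => hω _) fun _ _ => h _) (Finset.prod_nonneg fun _ _ => hm _)

open Filter Topology in
theorem le_of_forall_pow_div_le {s t : ℝ} (hs : 0 < s) (ht : 0 ≤ t) (K : ℕ)
    (h : ∀ M : ℕ, s ^ M / ((M : ℝ) + 1) ^ K ≤ t ^ M) : s ≤ t := by
  by_contra! hlt
  have hr : |t / s| < 1 := by
    rw [abs_of_nonneg (by positivity), div_lt_one hs]
    exact hlt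
  -- The constant `2 ^ K` absorbs the shift from `M + 1` to `M`, as `M + 1 ≤ 2 * M` for `M ≥ 1`.
  have hlim := (tendsto_pow_const_mul_const_pow_of_abs_lt_one K hr).const_mul ((2 : ℝ) ^ K)
  rw [mul_zero] at hlim
  obtain ⟨M, hM, hM1⟩ := ((hlim.eventually (gt_mem_nhds one_pos)).and (eventually_ge_atTop 1)).exists
  have hM1 : (1 : ℝ) ≤ M := by exact_mod_cast hM1
  have h1 := h M
  rw [div_le_iff₀ (by positivity)] at h1
  have h2 : ((M : ℝ) + 1) ^ K ≤ 2 ^ K * M ^ K := by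
    rw [← mul_pow]
    exact pow_le_pow_left₀ (by positivity) (by linarith) K
  have h3 : s ^ M ≤ t ^ M * (2 ^ K * M ^ K) := h1.trans (by gcongr)
  rw [div_pow, ← mul_assoc, ← mul_div_assoc, div_lt_one (by positivity)] at hM
  linarith

open Classical in
theorem FiniteSidorenko.edgeGluing {V₁ : Type u} {V₂ : Type v} [Fintype V₁] [Fintype V₂]
    {H₁ : SimpleGraph V₁} {H₂ : SimpleGraph V₂} (hH₁ : FiniteSidorenko.{u, w} H₁)
    (hH₂ : FiniteSidorenko.{v, w} H₂) {a₁ b₁ : V₁} {a₂ b₂ : V₂} (h₁ : H₁.Adj a₁ b₁)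
    (h₂ : H₂.Adj a₂ b₂) : FiniteSidorenko.{max u v, w} (edgeGluing H₁ H₂ a₁ b₁ a₂ b₂) := by
  intro α _ m ω hm hm1 hω
  set G := _root_.edgeGluing H₁ H₂ a₁ b₁ a₂ b₂ with hG
  have hD : G.edgeFinset.card ≠ 0 := by
    rw [hG, card_edgeFinset_edgeGluing H₁ H₂ h₁ h₂]
    have := one_le_card_edgeFinset h₁
    omega
  have ht := homSum_nonneg G hm fun e => (hω e).1
  rcases (edgeSum_nonneg hm fun e => (hω e).1).eq_or_lt with hp | hp
  · rwa [← hp, zero_pow hD]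
  set D := G.edgeFinset.card with hDdef
  set K := Fintype.card (α × α)
  -- The squares come from the `2M` coordinates; the loss `(M + 1) ^ K` is squared and then raised
  -- to the number `D` of edges.
  have key : ∀ M : ℕ, ((edgeSum m ω ^ D) ^ 2) ^ M / ((M : ℝ) + 1) ^ (K * 2 * D) ≤
      (homSum G m ω ^ 2) ^ M := by
    intro M
    obtain ⟨c, hc, hle⟩ := exists_symmetric_type_sum_ge M
      (g := fun p : α × α => m p.1 * m p.2 * ω s(p.1, p.2))
      (fun p => mul_nonneg (mul_nonneg (hm _) (hm _)) (hω _).1)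
      (fun p => by simp only [Prod.fst_swap, Prod.snd_swap, Sym2.eq_swap, mul_comm (m p.2)])
    rw [← edgeSum_tensorOfType m ω hc] at hle
    have hm' : ∀ x : Fin M ⊕ Fin M → α, 0 ≤ ∏ i, m (x i) :=
      fun x => Finset.prod_nonneg fun i _ => hm _
    have hm1' : ∑ x : Fin M ⊕ Fin M → α, ∏ i, m (x i) = 1 := by
      rw [sum_prod_comp_eq_pow, hm1, one_pow]
    have main := edgeSum_pow_le_homSum_edgeGluing_of_transitive hH₁ hH₂ h₁ h₂ hm' hm1'
      (tensorOfType_mem_Icc hω c) (tensorOfType_transitive m ω hc)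
    -- On the right the restriction to one type can be dropped at no cost, which restores a full
    -- tensor power.
    have hup := main.trans (homSum_mono _ hm' (fun e => (tensorOfType_mem_Icc hω c e).1)
      (tensorOfType_le hω c))
    rw [homSum_tensor, Fintype.card_sum, Fintype.card_fin, ← two_mul, pow_mul] at hup
    refine le_trans ?_ hup
    refine le_trans (le_of_eq ?_) (pow_le_pow_left₀ (by positivity) hle D)
    change _ = ((edgeSum m ω ^ M / ((M : ℝ) + 1) ^ K) ^ 2) ^ D
    rw [div_pow, div_pow]
    congr 1 <;> ring
  have := le_of_forall_pow_div_le (by positivity) (by positivity) _ key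
  exact (pow_le_pow_iff_left₀ (by positivity) ht two_ne_zero).1 this

end TensorPower

/-! ### Finite weighted targets as graphons, and continuity of densities. -/

section Measure

theorem Graphon.onPair_mem_Icc {Ω V : Type*} [MeasurableSpace Ω] (W : Graphon Ω) (x : V → Ω)
    (e : Sym2 V) : W.onPair x e ∈ Set.Icc (0 : ℝ) 1 := by
  induction e with | _ i j => exact W.mem_Icc' _ _

theorem Graphon.measurable_onPair {Ω V : Type*} [MeasurableSpace Ω] (W : Graphon Ω) (e : Sym2 V) :
    Measurable fun x : V → Ω => W.onPair x e := by
  induction e with | _ i j =>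
  have h : Measurable fun x : V → Ω => (x i, x j) :=
    (measurable_pi_apply i).prodMk (measurable_pi_apply j)
  exact W.measurable'.comp h

/-- The graphon on a finite space given by a weight on unordered pairs. -/
def Graphon.ofWeight {β : Type*} [Finite β] [MeasurableSpace β] [MeasurableSingletonClass β]
    (ω : Sym2 β → ℝ) (hω : ∀ e, ω e ∈ Set.Icc (0 : ℝ) 1) : Graphon β where
  toFun s t := ω s(s, t)
  measurable' := measurable_of_finite _
  symm' s t := by rw [Sym2.eq_swap]
  mem_Icc' s t := hω _

theorem Graphon.onPair_ofWeight {β V : Type*} [Finite β] [MeasurableSpace β]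
    [MeasurableSingletonClass β] (ω : Sym2 β → ℝ) (hω : ∀ e, ω e ∈ Set.Icc (0 : ℝ) 1) (x : V → β)
    (e : Sym2 V) : (Graphon.ofWeight ω hω).onPair x e = ω (e.map x) := by
  induction e with | _ i j => rfl

/-- The pullback of a graphon along a measurable map. -/
def Graphon.comap {Ω β : Type*} [MeasurableSpace Ω] [MeasurableSpace β] (W : Graphon β) (π : Ω → β)
    (hπ : Measurable π) : Graphon Ω where
  toFun x y := W.toFun (π x) (π y)
  measurable' := W.measurable'.comp
    ((hπ.comp measurable_fst).prodMk (hπ.comp measurable_snd))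
  symm' _ _ := W.symm' _ _
  mem_Icc' _ _ := W.mem_Icc' _ _

theorem Graphon.onPair_comap {Ω β V : Type*} [MeasurableSpace Ω] [MeasurableSpace β]
    (W : Graphon β) {π : Ω → β} (hπ : Measurable π) (x : V → Ω) (e : Sym2 V) :
    (W.comap π hπ).onPair x e = W.onPair (fun v => π (x v)) e := by
  induction e with | _ i j => rfl

theorem Graphon.measurable_prod_onPair {Ω V : Type*} [MeasurableSpace Ω] (W : Graphon Ω)
    (s : Finset (Sym2 V)) : Measurable fun x : V → Ω => ∏ e ∈ s, W.onPair x e :=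
  Finset.measurable_fun_prod _ fun e _ => W.measurable_onPair e

theorem Graphon.integrable_prod_onPair {Ω V : Type*} [MeasurableSpace Ω] (W : Graphon Ω)
    (s : Finset (Sym2 V)) (ν : Measure (V → Ω)) [IsFiniteMeasure ν] :
    Integrable (fun x : V → Ω => ∏ e ∈ s, W.onPair x e) ν := by
  refine Integrable.of_bound (W.measurable_prod_onPair s).aestronglyMeasurable 1
    (Filter.Eventually.of_forall fun x => ?_)
  rw [Real.norm_eq_abs, abs_of_nonneg (Finset.prod_nonneg fun e _ => (W.onPair_mem_Icc x e).1)]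
  exact Finset.prod_le_one (fun e _ => (W.onPair_mem_Icc x e).1) fun e _ => (W.onPair_mem_Icc x e).2

theorem graphonDensity_comap {Ω β V : Type*} [MeasurableSpace Ω] [MeasurableSpace β] [Fintype V]
    (H : SimpleGraph V) (μ : Measure Ω) [IsProbabilityMeasure μ] (W : Graphon β) {π : Ω → β}
    (hπ : Measurable π) : graphonDensity H μ (W.comap π hπ) = graphonDensity H (μ.map π) W := by
  have : IsProbabilityMeasure (μ.map π) := Measure.isProbabilityMeasure_map hπ.aemeasurable
  have h := measurePreserving_pi (fun _ : V => μ) (fun _ : V => μ.map π) (f := fun _ => π)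
    fun _ => hπ.measurePreserving μ
  simp only [graphonDensity]
  rw [← h.map_eq, integral_map h.measurable.aemeasurable
    (W.measurable_prod_onPair _).aestronglyMeasurable]
  simp only [Graphon.onPair_comap]

open Classical in
theorem graphonDensity_ofWeight {β V : Type*} [Fintype β] [MeasurableSpace β]
    [MeasurableSingletonClass β] [Fintype V] (H : SimpleGraph V) (ν : Measure β)
    [IsProbabilityMeasure ν] (ω : Sym2 β → ℝ) (hω : ∀ e, ω e ∈ Set.Icc (0 : ℝ) 1) :
    graphonDensity H ν (Graphon.ofWeight ω hω) = homSum H (fun b => ν.real {b}) ω := by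
  rw [graphonDensity, integral_fintype (Graphon.integrable_prod_onPair _ _ _), homSum]
  refine Finset.sum_congr rfl fun x _ => ?_
  simp only [Graphon.onPair_ofWeight, measureReal_def, Measure.pi_singleton, ENNReal.toReal_prod,
    smul_eq_mul]

open Classical in
theorem edgeFinset_pathGraph_two : (SimpleGraph.pathGraph 2).edgeFinset = {s(0, 1)} := by
  ext e
  induction e with | _ i j =>
  rw [SimpleGraph.mem_edgeFinset, SimpleGraph.mem_edgeSet, SimpleGraph.pathGraph_adj,
    Finset.mem_singleton]
  fin_cases i <;> fin_cases j <;> simp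

theorem homSum_pathGraph_two {β : Type*} [Fintype β] (m : β → ℝ) (ω : Sym2 β → ℝ) :
    homSum (SimpleGraph.pathGraph 2) m ω = edgeSum m ω := by
  classical
  refine Finset.sum_equiv (finTwoArrowEquiv β) (by simp) fun x _ => ?_
  rw [edgeFinset_pathGraph_two]
  simp

theorem IsSidorenko.finiteSidorenko {V : Type u} [Fintype V] {H : SimpleGraph V}
    (hH : IsSidorenko.{u, w} H) : FiniteSidorenko.{u, w} H := by
  intro β _ m ω hm hm1 hω
  classical
  let _ : MeasurableSpace β := ⊤
  have _ : MeasurableSingletonClass β := ⟨fun _ => trivial⟩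
  let ν : Measure β := ∑ b, ENNReal.ofReal (m b) • Measure.dirac b
  have hν : ∀ b, ν {b} = ENNReal.ofReal (m b) := fun b => by
    simp [ν, Measure.finsetSum_apply, Set.indicator_apply]
  have hprob : IsProbabilityMeasure ν := ⟨by
    simp [ν, Measure.finsetSum_apply, ← ENNReal.ofReal_sum_of_nonneg fun b _ => hm b, hm1]⟩
  have hreal : (fun b => ν.real {b}) = m := funext fun b => by
    rw [measureReal_def, hν, ENNReal.toReal_ofReal (hm b)]
  have h := hH.2 β ν (Graphon.ofWeight ω hω)
  rwa [graphonDensity_ofWeight, graphonDensity_ofWeight, homSum_pathGraph_two, hreal] at h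

/-- Densities are unchanged by pullback along `π`, so a step graphon behaves as a finite target
weighted by the masses of the classes. -/
theorem FiniteSidorenko.le_graphonDensity_comap {V : Type u} [Fintype V] {H : SimpleGraph V}
    (hH : FiniteSidorenko.{u, w} H) {Ω : Type*} [MeasurableSpace Ω] (μ : Measure Ω)
    [IsProbabilityMeasure μ] {β : Type w} [Fintype β] [MeasurableSpace β]
    [MeasurableSingletonClass β] {π : Ω → β} (hπ : Measurable π) (ω : Sym2 β → ℝ)
    (hω : ∀ e, ω e ∈ Set.Icc (0 : ℝ) 1) [Fintype H.edgeSet] :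
    graphonDensity (SimpleGraph.pathGraph 2) μ ((Graphon.ofWeight ω hω).comap π hπ) ^
      H.edgeFinset.card ≤ graphonDensity H μ ((Graphon.ofWeight ω hω).comap π hπ) := by
  have : IsProbabilityMeasure (μ.map π) := Measure.isProbabilityMeasure_map hπ.aemeasurable
  rw [graphonDensity_comap, graphonDensity_comap, graphonDensity_ofWeight, graphonDensity_ofWeight,
    homSum_pathGraph_two]
  have h1 : ∑ b, (μ.map π).real {b} = 1 := by
    rw [sum_measureReal_singleton, Finset.coe_univ, probReal_univ]
  convert hH β (fun b => (μ.map π).real {b}) ω (fun b => measureReal_nonneg) h1 hω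

theorem measurePreserving_pair {Ω V : Type*} [MeasurableSpace Ω] [Fintype V] (μ : Measure Ω)
    [IsProbabilityMeasure μ] {i j : V} (hij : i ≠ j) :
    MeasurePreserving (fun x : V → Ω => (x i, x j)) (Measure.pi fun _ => μ) (μ.prod μ) := by
  have hi := ProbabilityTheory.iIndepFun_pi (μ := fun _ : V => μ) (X := fun _ => id)
    fun _ => aemeasurable_id
  have h := (ProbabilityTheory.indepFun_iff_map_prod_eq_prod_map_map
    (measurable_pi_apply i).aemeasurable (measurable_pi_apply j).aemeasurable).1 (hi.indepFun hij)
  refine ⟨(measurable_pi_apply i).prodMk (measurable_pi_apply j), ?_⟩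
  refine h.trans ?_
  have hm : ∀ k : V, (Measure.pi fun _ : V => μ).map (fun x => x k) = μ := fun k =>
    (measurePreserving_eval (fun _ : V => μ) k).map_eq
  exact congrArg₂ Measure.prod (hm i) (hm j)

/-- Replace one factor at a time; the remaining factors are at most 1. -/
theorem abs_prod_sub_prod_le {ι : Type*} (s : Finset ι) {f g : ι → ℝ}
    (hf : ∀ i, f i ∈ Set.Icc (0 : ℝ) 1) (hg : ∀ i, g i ∈ Set.Icc (0 : ℝ) 1) :
    |∏ i ∈ s, f i - ∏ i ∈ s, g i| ≤ ∑ i ∈ s, |f i - g i| := by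
  classical
  induction s using Finset.induction_on with
  | empty => simp
  | insert a s ha ih =>
    rw [Finset.prod_insert ha, Finset.prod_insert ha, Finset.sum_insert ha]
    have h0 : 0 ≤ ∏ i ∈ s, f i := Finset.prod_nonneg fun i _ => (hf i).1
    have h1 : ∏ i ∈ s, f i ≤ 1 := Finset.prod_le_one (fun i _ => (hf i).1) fun i _ => (hf i).2
    calc |f a * ∏ i ∈ s, f i - g a * ∏ i ∈ s, g i|
        = |(f a - g a) * ∏ i ∈ s, f i + g a * (∏ i ∈ s, f i - ∏ i ∈ s, g i)| := by
          congr 1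
          ring
      _ ≤ |f a - g a| * |∏ i ∈ s, f i| + |g a| * |∏ i ∈ s, f i - ∏ i ∈ s, g i| := by
          rw [← abs_mul, ← abs_mul]
          exact abs_add_le _ _
      _ ≤ |f a - g a| * 1 + 1 * |∏ i ∈ s, f i - ∏ i ∈ s, g i| := by
          rw [abs_of_nonneg h0, abs_of_nonneg (hg a).1]
          have := (hg a).2
          gcongr
      _ ≤ _ := by linarith

theorem Graphon.integrable {Ω : Type*} [MeasurableSpace Ω] (W : Graphon Ω) (ν : Measure (Ω × Ω))
    [IsFiniteMeasure ν] : Integrable (fun p : Ω × Ω => W.toFun p.1 p.2) ν := by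
  refine Integrable.of_bound W.measurable'.aestronglyMeasurable 1
    (Filter.Eventually.of_forall fun p => ?_)
  rw [Real.norm_eq_abs, abs_of_nonneg (W.mem_Icc' _ _).1]
  exact (W.mem_Icc' _ _).2

/-- Subgraph densities are Lipschitz in the `L¹` distance. -/
theorem abs_graphonDensity_sub_le {Ω V : Type*} [MeasurableSpace Ω] [Fintype V]
    (H : SimpleGraph V) [Fintype H.edgeSet] (μ : Measure Ω) [IsProbabilityMeasure μ]
    (W W' : Graphon Ω) :
    |graphonDensity H μ W - graphonDensity H μ W'| ≤
      H.edgeFinset.card * ∫ p, |W.toFun p.1 p.2 - W'.toFun p.1 p.2| ∂(μ.prod μ) := by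
  classical
  have hd : ∀ U : Graphon Ω, graphonDensity H μ U =
      ∫ x : V → Ω, ∏ e ∈ H.edgeFinset, U.onPair x e ∂(Measure.pi fun _ : V => μ) := fun U => by
    rw [graphonDensity]
    congr!
  have hpair : ∀ e ∈ H.edgeFinset,
      Integrable (fun x => |W.onPair x e - W'.onPair x e|) (Measure.pi fun _ : V => μ) ∧
      ∫ x, |W.onPair x e - W'.onPair x e| ∂(Measure.pi fun _ : V => μ) =
        ∫ p, |W.toFun p.1 p.2 - W'.toFun p.1 p.2| ∂(μ.prod μ) := by
    intro e he
    induction e with | _ i j =>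
    -- Without loops, the endpoints of an edge are independent, so their joint law is `μ.prod μ`.
    have hij : i ≠ j := (show H.Adj i j by simpa using he).ne
    have hmp := measurePreserving_pair μ hij
    have hint := ((W.integrable (μ.prod μ)).sub (W'.integrable (μ.prod μ))).abs
    constructor
    · exact hmp.integrable_comp_of_integrable hint
    · rw [← hmp.map_eq, integral_map hmp.measurable.aemeasurable]
      · rfl
      · rw [hmp.map_eq]
        exact hint.aestronglyMeasurable
  rw [hd, hd, ← integral_sub (W.integrable_prod_onPair _ _) (W'.integrable_prod_onPair _ _)]
  calc _ ≤ ∫ x, |∏ e ∈ H.edgeFinset, W.onPair x e - ∏ e ∈ H.edgeFinset, W'.onPair x e|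
        ∂(Measure.pi fun _ : V => μ) := abs_integral_le_integral_abs
    _ ≤ ∫ x, ∑ e ∈ H.edgeFinset, |W.onPair x e - W'.onPair x e|
        ∂(Measure.pi fun _ : V => μ) := by
      refine integral_mono ((W.integrable_prod_onPair _ _).sub
        (W'.integrable_prod_onPair _ _)).abs (integrable_finsetSum _ fun e he => (hpair e he).1)
        fun x => ?_
      exact abs_prod_sub_prod_le _ (W.onPair_mem_Icc x) (W'.onPair_mem_Icc x)
    _ = _ := by
      rw [integral_finsetSum _ fun e he => (hpair e he).1,
        Finset.sum_congr rfl fun e he => (hpair e he).2, Finset.sum_const, nsmul_eq_mul]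

end Measure

/-! ### Approximation of graphons by symmetric step functions. -/

section Approximation

/-- A function on `Ω × Ω` that is approximable in `L¹` by functions of the classes of the two
coordinates in a finite measurable partition. -/
def IsStepApproximable {Ω : Type*} [MeasurableSpace Ω] (ν : Measure (Ω × Ω)) (f : Ω × Ω → ℝ) :
    Prop :=
  ∀ ε > 0, ∃ (β : Type w) (_ : Fintype β) (_ : MeasurableSpace β) (_ : MeasurableSingletonClass β)
    (π : Ω → β) (_ : Measurable π) (φ : β × β → ℝ), ∫ p, |f p - φ (π p.1, π p.2)| ∂ν ≤ ε

theorem integrable_step {Ω β : Type*} [MeasurableSpace Ω] (ν : Measure (Ω × Ω)) [IsFiniteMeasure ν]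
    [Fintype β] [MeasurableSpace β] [MeasurableSingletonClass β] {π : Ω → β} (hπ : Measurable π)
    (φ : β × β → ℝ) : Integrable (fun p : Ω × Ω => φ (π p.1, π p.2)) ν := by
  have hm : Measurable fun p : Ω × Ω => (π p.1, π p.2) :=
    (hπ.comp measurable_fst).prodMk (hπ.comp measurable_snd)
  refine Integrable.of_bound ((measurable_of_finite φ).comp hm).aestronglyMeasurable
    (∑ q, |φ q|) (Filter.Eventually.of_forall fun p => ?_)
  exact Finset.single_le_sum (f := fun q => |φ q|) (fun q _ => abs_nonneg _) (Finset.mem_univ _)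

/-- The sets that are unions of rectangles of a finite measurable partition. -/
def stepSets (Ω : Type*) [MeasurableSpace Ω] : Set (Set (Ω × Ω)) :=
  {A | ∃ (β : Type w) (_ : Fintype β) (_ : MeasurableSpace β) (_ : MeasurableSingletonClass β)
    (π : Ω → β) (_ : Measurable π) (S : Set (β × β)), A = {p | (π p.1, π p.2) ∈ S}}

theorem isSetAlgebra_stepSets (Ω : Type*) [MeasurableSpace Ω] :
    IsSetAlgebra (stepSets.{w} Ω) where
  empty_mem := ⟨PUnit, inferInstance, inferInstance, inferInstance, fun _ => PUnit.unit,
    measurable_const, ∅, by simp⟩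
  compl_mem := by
    rintro _ ⟨β, i₁, i₂, i₃, π, hπ, S, rfl⟩
    exact ⟨β, i₁, i₂, i₃, π, hπ, Sᶜ, rfl⟩
  union_mem := by
    rintro _ _ ⟨β, i₁, i₂, i₃, π, hπ, S, rfl⟩ ⟨β', i₁', i₂', i₃', π', hπ', S', rfl⟩
    -- Pairing the class maps gives a common refinement of the two partitions.
    exact ⟨β × β', inferInstance, inferInstance, inferInstance, fun x => (π x, π' x),
      hπ.prodMk hπ', {q | (q.1.1, q.2.1) ∈ S ∨ (q.1.2, q.2.2) ∈ S'}, rfl⟩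

theorem generateFrom_stepSets (Ω : Type*) [MeasurableSpace Ω] :
    (inferInstance : MeasurableSpace (Ω × Ω)) = MeasurableSpace.generateFrom (stepSets.{w} Ω) := by
  apply le_antisymm
  · rw [← generateFrom_prod]
    refine MeasurableSpace.generateFrom_mono ?_
    rintro _ ⟨A, hA, B, hB, rfl⟩
    -- The class of a point records its membership in `A` and in `B`; `ULift` only adjusts the
    -- universe.
    refine ⟨ULift (Prop × Prop), inferInstance, inferInstance,
      ⟨fun q => by
        convert measurable_down (measurableSet_singleton q.down)
        ext q'
        exact ULift.ext_iff⟩,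
      fun x => ⟨(x ∈ A, x ∈ B)⟩, ?_, {q | q.1.down.1 ∧ q.2.down.2}, rfl⟩
    exact measurable_up.comp ((measurable_mem.2 hA).prodMk (measurable_mem.2 hB))
  · refine MeasurableSpace.generateFrom_le ?_
    rintro _ ⟨β, i₁, i₂, i₃, π, hπ, S, rfl⟩
    have hm : Measurable fun p : Ω × Ω => (π p.1, π p.2) :=
      (hπ.comp measurable_fst).prodMk (hπ.comp measurable_snd)
    exact hm S.toFinite.measurableSet

theorem isStepApproximable_indicator {Ω : Type*} [MeasurableSpace Ω] (ν : Measure (Ω × Ω))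
    [IsFiniteMeasure ν] (c : ℝ) {s : Set (Ω × Ω)} (hs : MeasurableSet s) :
    IsStepApproximable.{w} ν (s.indicator fun _ => c) := by
  classical
  intro ε hε
  have hd := Measure.MeasureDense.of_generateFrom_isSetAlgebra_finite ν
    (isSetAlgebra_stepSets.{w} Ω) (generateFrom_stepSets.{w} Ω)
  -- The `+ 1` keeps the denominator positive when `c = 0`.
  obtain ⟨t, ht, hst⟩ := hd.approx s hs (measure_ne_top _ _) (ε / (|c| + 1)) (by positivity)
  have htm := hd.measurable t ht
  obtain ⟨β, i₁, i₂, i₃, π, hπ, S, rfl⟩ := ht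
  refine ⟨β, i₁, i₂, i₃, π, hπ, S.indicator fun _ => c, ?_⟩
  set t : Set (Ω × Ω) := {p | (π p.1, π p.2) ∈ S}
  have heq : (fun p : Ω × Ω => |s.indicator (fun _ => c) p -
      S.indicator (fun _ => c) (π p.1, π p.2)|) = (symmDiff s t).indicator fun _ => |c| := by
    ext p
    have hpt : (π p.1, π p.2) ∈ S ↔ p ∈ t := Iff.rfl
    simp only [Set.indicator_apply, hpt, Set.mem_symmDiff]
    by_cases h1 : p ∈ s <;> by_cases h2 : p ∈ t <;> simp [h1, h2]
  rw [heq, integral_indicator_const _ (hs.symmDiff htm), smul_eq_mul]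
  have h1 : ν.real (symmDiff s t) ≤ ε / (|c| + 1) :=
    ENNReal.toReal_le_of_le_ofReal (by positivity) hst.le
  calc _ ≤ ε / (|c| + 1) * (|c| + 1) := by gcongr; linarith
    _ = ε := div_mul_cancel₀ _ (by positivity)

theorem IsStepApproximable.add {Ω : Type*} [MeasurableSpace Ω] {ν : Measure (Ω × Ω)}
    [IsFiniteMeasure ν] {f g : Ω × Ω → ℝ} (hfi : Integrable f ν) (hgi : Integrable g ν)
    (hf : IsStepApproximable.{w} ν f) (hg : IsStepApproximable.{w} ν g) :
    IsStepApproximable.{w} ν (f + g) := by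
  intro ε hε
  obtain ⟨β, i₁, i₂, i₃, π, hπ, φ, h⟩ := hf (ε / 2) (by positivity)
  obtain ⟨β', i₁', i₂', i₃', π', hπ', φ', h'⟩ := hg (ε / 2) (by positivity)
  refine ⟨β × β', inferInstance, inferInstance, inferInstance, fun x => (π x, π' x),
    hπ.prodMk hπ', fun q => φ (q.1.1, q.2.1) + φ' (q.1.2, q.2.2), ?_⟩
  have hi : Integrable (fun p => |f p - φ (π p.1, π p.2)|) ν :=
    (hfi.sub (integrable_step ν hπ φ)).abs
  have hi' : Integrable (fun p => |g p - φ' (π' p.1, π' p.2)|) ν :=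
    (hgi.sub (integrable_step ν hπ' φ')).abs
  calc _ ≤ ∫ p, (|f p - φ (π p.1, π p.2)| + |g p - φ' (π' p.1, π' p.2)|) ∂ν := by
        refine integral_mono_of_nonneg (Filter.Eventually.of_forall fun _ => abs_nonneg _)
          (hi.add hi') (Filter.Eventually.of_forall fun p => ?_)
        refine le_trans (le_of_eq ?_) (abs_add_le _ _)
        simp only [Pi.add_apply]
        congr 1
        ring
    _ ≤ ε := by
      rw [integral_add hi hi']
      linarith

theorem IsStepApproximable.of_close {Ω : Type*} [MeasurableSpace Ω] {ν : Measure (Ω × Ω)}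
    [IsFiniteMeasure ν] {f : Ω × Ω → ℝ} (hfi : Integrable f ν)
    (h : ∀ ε > 0, ∃ g, Integrable g ν ∧ IsStepApproximable.{w} ν g ∧ ∫ p, |f p - g p| ∂ν ≤ ε) :
    IsStepApproximable.{w} ν f := by
  intro ε hε
  obtain ⟨g, hgi, hg, hfg⟩ := h (ε / 2) (by positivity)
  obtain ⟨β, i₁, i₂, i₃, π, hπ, φ, h⟩ := hg (ε / 2) (by positivity)
  refine ⟨β, i₁, i₂, i₃, π, hπ, φ, ?_⟩
  have hi : Integrable (fun p => |f p - g p|) ν := (hfi.sub hgi).abs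
  have hi' : Integrable (fun p => |g p - φ (π p.1, π p.2)|) ν :=
    (hgi.sub (integrable_step ν hπ φ)).abs
  calc _ ≤ ∫ p, (|f p - g p| + |g p - φ (π p.1, π p.2)|) ∂ν :=
        integral_mono_of_nonneg (Filter.Eventually.of_forall fun _ => abs_nonneg _)
          (hi.add hi') (Filter.Eventually.of_forall fun p => abs_sub_le _ _ _)
    _ ≤ ε := by
      rw [integral_add hi hi']
      linarith

theorem isStepApproximable_of_integrable {Ω : Type*} [MeasurableSpace Ω] {ν : Measure (Ω × Ω)}
    [IsFiniteMeasure ν] {f : Ω × Ω → ℝ} (hf : Integrable f ν) : IsStepApproximable.{w} ν f := by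
  refine Integrable.induction (IsStepApproximable.{w} ν) (fun c s hs _ =>
    isStepApproximable_indicator ν c hs) (fun f g _ hf hg h h' => h.add hf hg h') ?_ ?_ hf
  · refine isClosed_of_closure_subset fun F hF => ?_
    refine IsStepApproximable.of_close (L1.integrable_coeFn F) fun ε hε => ?_
    obtain ⟨G, hG, hd⟩ := Metric.mem_closure_iff.1 hF ε hε
    refine ⟨G, L1.integrable_coeFn G, hG, ?_⟩
    rw [L1.dist_eq_integral_dist] at hd
    exact hd.le
  · intro f g hfg hf h ε hε
    obtain ⟨β, i₁, i₂, i₃, π, hπ, φ, h⟩ := h ε hε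
    refine ⟨β, i₁, i₂, i₃, π, hπ, φ, le_of_eq_of_le (integral_congr_ae ?_) h⟩
    filter_upwards [hfg] with p hp
    rw [hp]

/-- Graphons are approximable in `L¹` by symmetric step functions with values in `[0,1]`. -/
theorem Graphon.exists_step_approx {Ω : Type*} [MeasurableSpace Ω] (μ : Measure Ω)
    [IsProbabilityMeasure μ] (W : Graphon Ω) {ε : ℝ} (hε : 0 < ε) :
    ∃ (β : Type w) (_ : Fintype β) (_ : MeasurableSpace β) (_ : MeasurableSingletonClass β)
      (π : Ω → β) (hπ : Measurable π) (ω : Sym2 β → ℝ) (hω : ∀ e, ω e ∈ Set.Icc (0 : ℝ) 1),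
      ∫ p, |W.toFun p.1 p.2 - ((Graphon.ofWeight ω hω).comap π hπ).toFun p.1 p.2| ∂(μ.prod μ) ≤
        ε := by
  obtain ⟨β, i₁, i₂, i₃, π, hπ, φ, h⟩ :=
    isStepApproximable_of_integrable.{w} (W.integrable (μ.prod μ)) ε hε
  -- Averaging over the two orders and clamping to `[0,1]` preserve the error bound, since `W` is
  -- symmetric and `[0,1]`-valued.
  let ω : Sym2 β → ℝ := fun e => max 0 (min 1
    (Sym2.lift ⟨fun s t => (φ (s, t) + φ (t, s)) / 2, fun s t => congrArg (· / 2) (add_comm _ _)⟩ e))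
  have hω : ∀ e, ω e ∈ Set.Icc (0 : ℝ) 1 := fun e =>
    ⟨le_max_left _ _, max_le zero_le_one (min_le_left _ _)⟩
  refine ⟨β, i₁, i₂, i₃, π, hπ, ω, hω, ?_⟩
  have hi : Integrable (fun p : Ω × Ω => |W.toFun p.1 p.2 - φ (π p.1, π p.2)|) (μ.prod μ) :=
    ((W.integrable (μ.prod μ)).sub (integrable_step (μ.prod μ) hπ φ)).abs
  have hi' : Integrable (fun p : Ω × Ω => |W.toFun p.2 p.1 - φ (π p.2, π p.1)|) (μ.prod μ) :=
    hi.swap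
  have hs : ∫ p : Ω × Ω, |W.toFun p.2 p.1 - φ (π p.2, π p.1)| ∂(μ.prod μ) ≤ ε :=
    le_of_eq_of_le
      (integral_prod_swap (fun p : Ω × Ω => |W.toFun p.1 p.2 - φ (π p.1, π p.2)|)) h
  calc _ ≤ ∫ p : Ω × Ω, (|W.toFun p.1 p.2 - φ (π p.1, π p.2)| +
          |W.toFun p.2 p.1 - φ (π p.2, π p.1)|) / 2 ∂(μ.prod μ) := by
        refine integral_mono_of_nonneg (Filter.Eventually.of_forall fun _ => abs_nonneg _)
          ((hi.add hi').div_const 2) (Filter.Eventually.of_forall fun p => ?_)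
        obtain ⟨x, y⟩ := p
        change |W.toFun x y - max 0 (min 1 ((φ (π x, π y) + φ (π y, π x)) / 2))| ≤
          (|W.toFun x y - φ (π x, π y)| + |W.toFun y x - φ (π y, π x)|) / 2
        obtain ⟨h0, h1⟩ := W.mem_Icc' x y
        -- Clamping fixes `W` and is 1-Lipschitz.
        have hW : W.toFun x y = max 0 (min 1 (W.toFun x y)) := by
          rw [min_eq_right h1, max_eq_right h0]
        rw [W.symm' y x]
        calc _ ≤ |W.toFun x y - (φ (π x, π y) + φ (π y, π x)) / 2| := by
              nth_rw 1 [hW]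
              refine (abs_max_sub_max_le_max _ _ _ _).trans ?_
              rw [sub_self, abs_zero, max_eq_right (abs_nonneg _)]
              refine (abs_min_sub_min_le_max _ _ _ _).trans ?_
              rw [sub_self, abs_zero, max_eq_right (abs_nonneg _)]
          _ = |(W.toFun x y - φ (π x, π y)) + (W.toFun x y - φ (π y, π x))| / 2 := by
              rw [← abs_two (α := ℝ), ← abs_div, abs_two]
              congr 1
              ring
          _ ≤ _ := by
              gcongr
              exact abs_add_le _ _
    _ ≤ ε := by
      rw [integral_div, integral_add hi hi']
      linarith

open Filter Topology in
theorem tendsto_graphonDensity {Ω V : Type*} [MeasurableSpace Ω] [Fintype V] (H : SimpleGraph V)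
    (μ : Measure Ω) [IsProbabilityMeasure μ] (W : Graphon Ω) {U : ℕ → Graphon Ω}
    (hU : ∀ n : ℕ, ∫ p, |W.toFun p.1 p.2 - (U n).toFun p.1 p.2| ∂(μ.prod μ) ≤ 1 / ((n : ℝ) + 1)) :
    Tendsto (fun n => graphonDensity H μ (U n)) atTop (𝓝 (graphonDensity H μ W)) := by
  classical
  have h0 := (tendsto_one_div_add_atTop_nhds_zero_nat (𝕜 := ℝ)).const_mul
    (H.edgeFinset.card : ℝ)
  rw [mul_zero] at h0
  rw [tendsto_iff_dist_tendsto_zero]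
  refine squeeze_zero (fun _ => dist_nonneg) (fun n => ?_) h0
  rw [dist_comm, Real.dist_eq]
  exact (abs_graphonDensity_sub_le H μ W (U n)).trans
    (mul_le_mul_of_nonneg_left (hU n) (Nat.cast_nonneg _))

open Classical in
theorem FiniteSidorenko.isSidorenko {V : Type u} [Fintype V] {H : SimpleGraph V}
    (hH : FiniteSidorenko.{u, w} H) (hb : H.IsBipartite) : IsSidorenko.{u, w} H := by
  refine ⟨hb, fun Ω _ μ _ W => ?_⟩
  choose β i₁ i₂ i₃ π hπ ω hω hδ using fun n : ℕ =>
    W.exists_step_approx.{w} μ (ε := 1 / ((n : ℝ) + 1)) (by positivity)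
  exact le_of_tendsto_of_tendsto' ((tendsto_graphonDensity _ μ W hδ).pow _)
    (tendsto_graphonDensity H μ W hδ) fun n => hH.le_graphonDensity_comap μ (hπ n) (ω n) (hω n)

end Approximation

/-! ### Bipartiteness of the glued graph and conclusion. -/

theorem SimpleGraph.IsBipartite.edgeGluing {V₁ V₂ : Type*} {H₁ : SimpleGraph V₁}
    {H₂ : SimpleGraph V₂} (hb₁ : H₁.IsBipartite) (hb₂ : H₂.IsBipartite) {a₁ b₁ : V₁} {a₂ b₂ : V₂}
    (h₁ : H₁.Adj a₁ b₁) (h₂ : H₂.Adj a₂ b₂) : (edgeGluing H₁ H₂ a₁ b₁ a₂ b₂).IsBipartite := by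
  obtain ⟨C₁⟩ := hb₁
  obtain ⟨C₂⟩ := hb₂
  -- Recolour the second graph to agree at the first root; with only two colours, agreement at the
  -- other root follows from properness.
  let σ : Equiv.Perm (Fin 2) := Equiv.swap (C₂ a₂) (C₁ a₁)
  have hσa : σ (C₂ a₂) = C₁ a₁ := Equiv.swap_apply_left _ _
  have hσb : σ (C₂ b₂) = C₁ b₁ := by
    have n₁ := C₁.valid h₁
    have n₂ : σ (C₂ a₂) ≠ σ (C₂ b₂) := σ.injective.ne (C₂.valid h₂)
    rw [hσa] at n₂
    omega
  let C : GluedVertex V₁ a₂ b₂ → Fin 2 := Sum.elim C₁ fun v => σ (C₂ v)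
  have hC : ∀ v, C (gluedVertexOfRight a₁ b₁ a₂ b₂ v) = σ (C₂ v) := by
    intro v
    simp only [gluedVertexOfRight]
    split_ifs with ha hb
    · rw [ha, hσa]
      rfl
    · rw [hb, hσb]
      rfl
    · rfl
  refine ⟨SimpleGraph.Coloring.mk C ?_⟩
  intro x y hxy
  rcases hxy with h | h
  · obtain ⟨-, u, v, huv, rfl, rfl⟩ := h
    exact C₁.valid huv
  · obtain ⟨-, u, v, huv, rfl, rfl⟩ := h
    rw [hC, hC]
    exact σ.injective.ne (C₂.valid huv)

theorem mainTheorem2 {V₁ : Type u} {V₂ : Type v} [Fintype V₁] [Fintype V₂]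
    (H₁ : SimpleGraph V₁) (H₂ : SimpleGraph V₂)
    (hH₁ : IsSidorenko.{u, w} H₁) (hH₂ : IsSidorenko.{v, w} H₂)
    (a₁ b₁ : V₁) (a₂ b₂ : V₂) (he₁ : H₁.Adj a₁ b₁) (he₂ : H₂.Adj a₂ b₂) :
    IsSidorenko.{max u v, w} (edgeGluing H₁ H₂ a₁ b₁ a₂ b₂) :=
  (hH₁.finiteSidorenko.edgeGluing hH₂.finiteSidorenko he₁ he₂).isSidorenko
    (hH₁.1.edgeGluing hH₂.1 he₁ he₂)
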